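/- Let $H_0,\dots,H_M$ be Hermitian complex $D\times D$ matrices, let $h_0,\dots,h_M$ be real-valued functions of time, let $T\ge 0$, and suppose that $H(t)=\sum_{m=0}^M h_m(t)H_m$ is bounded and piecewise continuous on $[0,T]$. Let $U$ be a continuous matrix-valued function on $[0,T]$ that solves $i\,\frac{d}{dt}U(t)=H(t)U(t)$ (at all but finitely many $t\in[0,T]$) with $U(0)=I$. Let $\mathcal L(\{iH_m\})$ be the real Lie algebra generated by the matrices $iH_0,\dots,iH_M$ under the commutator, and let $\|A\|_F=\sqrt{\operatorname{tr}A^\dagger A}$ be the Frobenius norm. Then there is a Hermitian matrix $C[T]$ such that $$e^{-iC[T]}=U(T),\qquad iC[T]\in\mathcal L(\{iH_m\}),\qquad \|C[T]\|_F\le\int_0^T\|H(t)\|_F\,dt .$$ Consequently, the minimum $c$ of $\|C\|_F$ over all Hermitian $C$ with $iC\in\mathcal L(\{iH_m\})$ and $e^{-iC}=U(T)$ exists and satisfies $c\le T\sup_{0\le t\le T}\|H(t)\|_F$; in particular, if $U(T)\ne I$, then $\sup_{0\le t\le T}\|H(t)\|_F>0$ and $$T\ \ge\ \frac{c}{\sup_{0\le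 t\le T}\|H(t)\|_F}.$$ -/

import Mathlib

noncomputable section

attribute [local instance 100] LieRing.ofAssociativeRing

/-- The Frobenius norm `‖A‖_F = √(tr (A† A))` of a complex square matrix. -/
def frobeniusNorm {D : ℕ} (A : Matrix (Fin D) (Fin D) ℂ) : ℝ :=
  Real.sqrt (Matrix.trace (A.conjTranspose * A)).re

/-- The time-dependent Hamiltonian `H(t) = ∑ m, h m t • H m` with drift/control Hamiltonians
`H 0, …, H M` and real modulations `h 0, …, h M`. -/
def hamiltonian {D M : ℕ} (H : Fin (M + 1) → Matrix (Fin D) (Fin D) ℂ)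
    (h : Fin (M + 1) → ℝ → ℝ) (t : ℝ) : Matrix (Fin D) (Fin D) ℂ :=
  ∑ m, ((h m t : ℝ) : ℂ) • H m

/-- Bounded piecewise continuity on `[0, T]`: `F` is bounded there and continuous away from
finitely many points. A function that is continuous on finitely many pieces with finite one-sided
limits at the break points satisfies this; the existence of the limits is not required. -/
def IsPiecewiseContinuous {D : ℕ} (F : ℝ → Matrix (Fin D) (Fin D) ℂ) (T : ℝ) : Prop :=
  (∃ B : ℝ, ∀ t ∈ Set.Icc (0 : ℝ) T, frobeniusNorm (F t) ≤ B) ∧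
    ∃ S : Set ℝ, S.Finite ∧ ContinuousOn F (Set.Icc (0 : ℝ) T \ S)

/-- `U` solves `i dU/dt = F(t) U(t)`, `U(0) = I` on `[0, T]`, in the usual sense for a piecewise
continuous `F`: `U` is continuous and the equation holds at all but finitely many times. -/
def IsSchrodingerSolution {D : ℕ} (F : ℝ → Matrix (Fin D) (Fin D) ℂ) (T : ℝ)
    (U : ℝ → Matrix (Fin D) (Fin D) ℂ) : Prop :=
  U 0 = 1 ∧ ContinuousOn U (Set.Icc (0 : ℝ) T) ∧
    ∃ S : Set ℝ, S.Finite ∧ ∀ t ∈ Set.Icc (0 : ℝ) T \ S,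
      ∃ U' : Matrix (Fin D) (Fin D) ℂ,
        HasDerivWithinAt U U' (Set.Icc (0 : ℝ) T) t ∧ Complex.I • U' = F t * U t

/-- The dynamical Lie algebra: the real Lie subalgebra of the `D × D` complex matrices, with the
commutator bracket, generated by the matrices `i H m`. -/
def dynamicalLieAlgebra {D M : ℕ} (H : Fin (M + 1) → Matrix (Fin D) (Fin D) ℂ) :
    LieSubalgebra ℝ (Matrix (Fin D) (Fin D) ℂ) :=
  LieSubalgebra.lieSpan ℝ (Matrix (Fin D) (Fin D) ℂ) (Set.range fun m => Complex.I • H m)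

/-- The Hermitian `C` with `i C` in the dynamical Lie algebra and `exp (-i C) = V`. -/
def hermitianGenerators {D M : ℕ} (H : Fin (M + 1) → Matrix (Fin D) (Fin D) ℂ)
    (V : Matrix (Fin D) (Fin D) ℂ) : Set (Matrix (Fin D) (Fin D) ℂ) :=
  {C | C.IsHermitian ∧ NormedSpace.exp (-(Complex.I • C)) = V ∧
    Complex.I • C ∈ dynamicalLieAlgebra H}

end

/-! The matrices `-iH(t)` lie in a Lie algebra `L` of skew-Hermitian matrices, on which `Re tr (A†
B)` is ad-invariant. Geometrically this is a bi-invariant metric: one-parameter subgroups are its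
geodesics, and `U(T)` should be joined to `I` by a geodesic no longer than the path `U`. The group
generated by `exp L` need not be closed, so compactness is used only in closed balls of the
finite-dimensional space `L`.

The core is the inequality behind `exists_exp_eq_exp_mul_exp`: for `a, b ∈ L`, `exp a * exp b = exp
C` with `C ∈ L` and `‖C‖ ≤ ‖a‖ + ‖b‖`. Cut both factors into short pieces and minimize a discrete
energy among chains in `L` with the same product. A Gauss lemma (`apply_exp_neg_mul_fderiv_exp`)
gives the first variation when a factor `exp (s • X)` is inserted between neighbours. At a minimizer
all pieces are therefore multiples of one vector, and the chain collapses to a single exponential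
(`exists_straightening`).

Finally `U(T)` is a limit of products of exponentials of `∫ F` over short intervals, where `F =
-iH`. Merging the factors one by one keeps the norm below `∫ ‖F‖`, and compactness of a ball in `L`
passes to the limit. -/

noncomputable section

open NormedSpace Filter Topology

/-! ### The derivative of the exponential. -/

section ExpDeriv

variable {𝔸 : Type*} [NormedRing 𝔸] [NormedAlgebra ℝ 𝔸] [CompleteSpace 𝔸]

theorem continuous_exp_real : Continuous (exp : 𝔸 → 𝔸) :=
  let _ := NormedAlgebra.restrictScalars ℚ ℝ 𝔸
  exp_continuous

theorem exp_mul_exp_neg (a : 𝔸) : exp a * exp (-a) = 1 := by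
  let _ := NormedAlgebra.restrictScalars ℚ ℝ 𝔸
  rw [← exp_add_of_commute (Commute.neg_right (Commute.refl a)), add_neg_cancel, exp_zero]

theorem exp_neg_mul_exp (a : 𝔸) : exp (-a) * exp a = 1 := by
  simpa using exp_mul_exp_neg (-a)

theorem hasDerivAt_exp_smul (a : 𝔸) (t : ℝ) :
    HasDerivAt (fun s : ℝ => exp (s • a)) (exp (t • a) * a) t :=
  hasDerivAt_exp_smul_const a t

theorem hasDerivAt_exp_neg_smul (a : 𝔸) (t : ℝ) :
    HasDerivAt (fun s : ℝ => exp (-(s • a))) (-(a * exp (-(t • a)))) t := by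
  simpa using hasDerivAt_exp_smul_const' (-a) t

theorem contDiff_exp_real : ContDiff ℝ ⊤ (exp : 𝔸 → 𝔸) :=
  contDiff_iff_contDiffAt.2 fun x => (exp_analytic x).contDiffAt

/-- Duhamel's formula. -/
theorem exp_neg_mul_exp_add_smul (a y : 𝔸) (s : ℝ) :
    exp (-a) * exp (a + s • y) =
      1 + s • ∫ τ in (0 : ℝ)..1, exp (-(τ • a)) * y * exp (τ • (a + s • y)) := by
  have hd : ∀ τ : ℝ, HasDerivAt (fun τ : ℝ => exp (-(τ • a)) * exp (τ • (a + s • y)))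
      (s • (exp (-(τ • a)) * y * exp (τ • (a + s • y)))) τ := by
    intro τ
    convert (hasDerivAt_exp_neg_smul a τ).fun_mul (hasDerivAt_exp_smul_const' (a + s • y) τ) using 1
    have : a * exp (-(τ • a)) = exp (-(τ • a)) * a :=
      ((((Commute.refl a).smul_right τ).neg_right).exp_right).eq
    rw [this]
    simp only [mul_add, add_mul, mul_smul_comm, smul_mul_assoc, neg_mul, mul_assoc]
    abel
  have hc : Continuous fun τ : ℝ => exp (-(τ • a)) * y * exp (τ • (a + s • y)) := by
    have := continuous_exp_real (𝔸 := 𝔸)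
    fun_prop
  have := intervalIntegral.integral_eq_sub_of_hasDerivAt (a := 0) (b := 1)
    (fun τ _ => hd τ) ((hc.const_smul s).intervalIntegrable _ _)
  rw [intervalIntegral.integral_smul] at this
  rw [this]
  simp

theorem fderiv_exp_apply (a y : 𝔸) :
    fderiv ℝ exp a y = exp a * ∫ τ in (0 : ℝ)..1, exp (-(τ • a)) * y * exp (τ • a) := by
  set G : ℝ → 𝔸 := fun s => ∫ τ in (0 : ℝ)..1, exp (-(τ • a)) * y * exp (τ • (a + s • y)) with hG
  have hGc : Continuous G := by
    apply intervalIntegral.continuous_parametric_intervalIntegral_of_continuous'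
    have := continuous_exp_real (𝔸 := 𝔸)
    simp only [Function.uncurry_def]
    fun_prop
  -- At `s = 0` continuity of `G` is enough: the difference quotient of `s • G s` is `G s` itself.
  have h1 : HasDerivAt (fun s : ℝ => s • G s) (G 0) 0 := by
    rw [hasDerivAt_iff_tendsto_slope]
    refine Tendsto.congr' ?_ ((hGc.tendsto 0).mono_left nhdsWithin_le_nhds)
    filter_upwards [self_mem_nhdsWithin] with s hs
    have hs : s ≠ 0 := hs
    simp [slope_def_module, smul_smul, hs]
  have h2 : HasDerivAt (fun s : ℝ => exp (a + s • y)) (exp a * G 0) 0 := by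
    have h3 := (h1.const_add 1).const_mul (exp a)
    refine h3.congr_of_eventuallyEq (Eventually.of_forall fun s => ?_)
    simp only [hG]
    rw [← exp_neg_mul_exp_add_smul, ← mul_assoc, exp_mul_exp_neg, one_mul]
  have h4 : HasDerivAt (fun s : ℝ => exp (a + s • y)) (fderiv ℝ exp a y) 0 := by
    have hd : HasFDerivAt (exp : 𝔸 → 𝔸) (fderiv ℝ exp a) (a + (0 : ℝ) • y) := by
      simpa using (contDiff_exp_real.differentiable (by simp) a).hasFDerivAt
    have hl : HasDerivAt (fun s : ℝ => a + s • y) y 0 := by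
      simpa using ((hasDerivAt_id (0 : ℝ)).smul_const y).const_add a
    exact hd.comp_hasDerivAt (0 : ℝ) hl
  rw [h4.unique h2]
  simp [hG]

end ExpDeriv

/-! ### Conjugation by exponentials and the Gauss lemma. -/

section Adjoint

variable {𝔸 : Type*} [NormedRing 𝔸] [NormedAlgebra ℝ 𝔸] [FiniteDimensional ℝ 𝔸] [CompleteSpace 𝔸]

/-- The endomorphism `y ↦ y a - a y` of a commutator-closed submodule. -/
def commutatorRight (L : Submodule ℝ 𝔸) (hL : ∀ a ∈ L, ∀ b ∈ L, a * b - b * a ∈ L) (a : L) :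
    L →L[ℝ] L :=
  LinearMap.toContinuousLinearMap
    { toFun := fun y => ⟨y * a - a * y, hL y y.2 a a.2⟩
      map_add' := fun x y => by ext; simp only [Submodule.coe_add]; noncomm_ring
      map_smul' := fun r x => by ext; simp [smul_sub] }

variable {L : Submodule ℝ 𝔸} (hL : ∀ a ∈ L, ∀ b ∈ L, a * b - b * a ∈ L)

theorem exists_hasDerivAt_clm {V : Type*} [NormedAddCommGroup V] [NormedSpace ℝ V]
    [CompleteSpace V] (D : V →L[ℝ] V) (y : V) :
    ∃ E : ℝ → V, E 0 = y ∧ ∀ t, HasDerivAt E (D (E t)) t :=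
  ⟨fun t => exp (t • D) y, by simp, fun t =>
    (ContinuousLinearMap.apply ℝ V y).hasFDerivAt.comp_hasDerivAt t
      (hasDerivAt_exp_smul_const' D t)⟩

include hL in
/-- A commutator-closed submodule is stable under conjugation by exponentials of its elements. -/
theorem exp_neg_mul_mul_exp_mem {a y : 𝔸} (ha : a ∈ L) (hy : y ∈ L) :
    exp (-a) * y * exp a ∈ L := by
  obtain ⟨E, hE0, hE'⟩ := exists_hasDerivAt_clm (commutatorRight L hL ⟨a, ha⟩) ⟨y, hy⟩
  have hEd : ∀ t, HasDerivAt (fun t => (E t : 𝔸)) (E t * a - a * E t) t := fun t =>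
    L.subtypeL.hasFDerivAt.comp_hasDerivAt t (hE' t)
  -- `E` solves `E' = E a - a E` inside `L`. Undoing the conjugation gives a constant, so `E 1` is
  -- the conjugate of `y`.
  have hz : ∀ t, HasDerivAt (fun t : ℝ => exp (t • a) * E t * exp (-(t • a))) 0 t := by
    intro t
    convert ((hasDerivAt_exp_smul a t).fun_mul (hEd t)).fun_mul
      (hasDerivAt_exp_neg_smul a t) using 1
    noncomm_ring
  have hconst := is_const_of_deriv_eq_zero (fun t => (hz t).differentiableAt)
    (fun t => (hz t).deriv) 1 0
  have h1 := exp_neg_mul_exp a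
  have h2 : exp a * E 1 * exp (-a) = y := by simpa [hE0] using hconst
  have : exp (-a) * y * exp a = E 1 := by
    calc exp (-a) * y * exp a
        = (exp (-a) * exp a) * E 1 * (exp (-a) * exp a) := by rw [← h2]; simp only [mul_assoc]
      _ = _ := by simp [h1]
  rw [this]
  exact (E 1).2

/-- A linear projection onto `L` fixes the integrand and commutes with the integral. -/
theorem intervalIntegral_mem_submodule (L : Submodule ℝ 𝔸) {f : ℝ → 𝔸} {a b : ℝ} (hab : a ≤ b)
    (hf : ∀ t ∈ Set.Icc a b, f t ∈ L) (hi : IntervalIntegrable f MeasureTheory.volume a b) :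
    ∫ t in a..b, f t ∈ L := by
  obtain ⟨P, hP⟩ := L.exists_isCompl
  let Q : 𝔸 →L[ℝ] 𝔸 := LinearMap.toContinuousLinearMap (L.subtype ∘ₗ L.projectionOnto P hP)
  have hQ : ∀ x ∈ L, Q x = x := fun x hx => by
    simp [Q, Submodule.projectionOnto_apply_left hP ⟨x, hx⟩]
  have hQL : ∀ x, Q x ∈ L := fun x => by simp [Q]
  have : ∫ t in a..b, f t = Q (∫ t in a..b, f t) := by
    rw [← Q.intervalIntegral_comp_comm hi]
    refine intervalIntegral.integral_congr fun t ht => ?_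
    rw [Set.uIcc_of_le hab] at ht
    exact (hQ _ (hf t ht)).symm
  rw [this]
  exact hQL _

include hL in
theorem exp_neg_mul_fderiv_exp_mem {a y : 𝔸} (ha : a ∈ L) (hy : y ∈ L) :
    exp (-a) * fderiv ℝ exp a y ∈ L := by
  rw [fderiv_exp_apply, ← mul_assoc, exp_neg_mul_exp, one_mul]
  have hc : Continuous fun τ : ℝ => exp (-(τ • a)) * y * exp (τ • a) := by
    have := continuous_exp_real (𝔸 := 𝔸)
    fun_prop
  refine intervalIntegral_mem_submodule L zero_le_one (fun t _ => ?_) (hc.intervalIntegrable _ _)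
  exact exp_neg_mul_mul_exp_mem hL (L.smul_mem t ha) hy

include hL in
-- Gauss lemma, applied later with `φ = B a`: along `t ↦ exp (-(t • a)) * y * exp (t • a)` the
-- derivative is a commutator with `a`, which `φ` kills, so averaging over `t` leaves `φ y`.
theorem apply_exp_neg_mul_fderiv_exp {a y : 𝔸} (ha : a ∈ L) (hy : y ∈ L) (φ : 𝔸 →L[ℝ] ℝ)
    (hφ : ∀ z ∈ L, φ (z * a - a * z) = 0) :
    φ (exp (-a) * fderiv ℝ exp a y) = φ y := by
  rw [fderiv_exp_apply, ← mul_assoc, exp_neg_mul_exp, one_mul]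
  have hc : Continuous fun τ : ℝ => exp (-(τ • a)) * y * exp (τ • a) := by
    have := continuous_exp_real (𝔸 := 𝔸)
    fun_prop
  rw [← φ.intervalIntegral_comp_comm (hc.intervalIntegrable _ _)]
  have hconst : ∀ t : ℝ, φ (exp (-(t • a)) * y * exp (t • a)) = φ y := by
    intro t
    have key : ∀ t : ℝ, HasDerivAt (fun t : ℝ => φ (exp (-(t • a)) * y * exp (t • a))) 0 t := by
      intro t
      have h1 := φ.hasFDerivAt.comp_hasDerivAt t
        (((hasDerivAt_exp_neg_smul a t).mul_const y).fun_mul (hasDerivAt_exp_smul_const' a t))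
      refine h1.congr_deriv ?_
      rw [← hφ _ (exp_neg_mul_mul_exp_mem hL (L.smul_mem t ha) hy)]
      have : Commute a (exp (t • a)) := ((Commute.refl a).smul_right t).exp_right
      congr 1
      simp only [mul_assoc, this.eq]
      noncomm_ring
    have := is_const_of_deriv_eq_zero (fun t => (key t).differentiableAt)
      (fun t => (key t).deriv) t 0
    simpa using this
  simp [hconst]

end Adjoint

end

noncomputable section

open NormedSpace Filter Topology

/-! ### Local logarithms inside `L` and the first variation of the squared norm. -/

section LocalLog

variable {𝔸 : Type*} [NormedRing 𝔸] [NormedAlgebra ℝ 𝔸] [FiniteDimensional ℝ 𝔸] [CompleteSpace 𝔸]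
variable {L : Submodule ℝ 𝔸} (hL : ∀ a ∈ L, ∀ b ∈ L, a * b - b * a ∈ L)

/-- The logarithmic derivative of `exp` at points of `L`, compressed to `L` by a map `Q`. -/
def expLogDeriv (Q : 𝔸 →L[ℝ] L) (a : L) : L →L[ℝ] L :=
  (Q.comp (ContinuousLinearMap.mul ℝ 𝔸 (exp (-(a : 𝔸))))).comp
    ((fderiv ℝ exp (a : 𝔸)).comp L.subtypeL)

omit [FiniteDimensional ℝ 𝔸] [CompleteSpace 𝔸] in
theorem expLogDeriv_apply (Q : 𝔸 →L[ℝ] L) (a v : L) :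
    expLogDeriv Q a v = Q (exp (-(a : 𝔸)) * fderiv ℝ exp (a : 𝔸) v) := rfl

omit [FiniteDimensional ℝ 𝔸] in
theorem contDiff_expLogDeriv (Q : 𝔸 →L[ℝ] L) : ContDiff ℝ 1 (expLogDeriv Q) := by
  have h1 : ContDiff ℝ 1 (exp : 𝔸 → 𝔸) := contDiff_exp_real.of_le (by simp)
  have h2 : ContDiff ℝ 1 (fderiv ℝ (exp : 𝔸 → 𝔸)) :=
    (contDiff_exp_real (𝔸 := 𝔸)).fderiv_right (m := 1) (by simp)
  have h3 : ContDiff ℝ 1 fun a : L => (a : 𝔸) := L.subtypeL.contDiff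
  have h4 : ContDiff ℝ 1 fun a : L => ContinuousLinearMap.mul ℝ 𝔸 (exp (-(a : 𝔸))) :=
    (ContinuousLinearMap.mul ℝ 𝔸).contDiff.comp (h1.comp h3.neg)
  have h5 : ContDiff ℝ 1 fun a : L => fderiv ℝ exp (a : 𝔸) := h2.comp h3
  exact (contDiff_const.clm_comp h4).clm_comp (h5.clm_comp contDiff_const)

omit [FiniteDimensional ℝ 𝔸] in
theorem expLogDeriv_zero {Q : 𝔸 →L[ℝ] L} (hQ : ∀ x : L, Q x = x) :
    expLogDeriv Q 0 = ContinuousLinearMap.id ℝ L := by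
  ext v
  rw [expLogDeriv_apply]
  have : fderiv ℝ (exp : 𝔸 → 𝔸) ((0 : L) : 𝔸) = ContinuousLinearMap.id ℝ 𝔸 := by
    exact (hasFDerivAt_exp_zero (𝕂 := ℝ) (𝔸 := 𝔸)).fderiv
  rw [this]
  simp [hQ]

omit [CompleteSpace 𝔸] in
theorem exists_clm_retraction (L : Submodule ℝ 𝔸) : ∃ Q : 𝔸 →L[ℝ] L, ∀ x : L, Q x = x := by
  obtain ⟨P, hP⟩ := L.exists_isCompl
  exact ⟨LinearMap.toContinuousLinearMap (L.projectionOnto P hP), fun x =>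
    Submodule.projectionOnto_apply_left hP x⟩

include hL in
/-- Near `0`, the curve `s ↦ exp a * exp (s • X)` lifts through `exp` to a curve in `L`. -/
theorem exists_local_log_curve :
    ∃ δ > (0 : ℝ), ∀ a ∈ L, ‖a‖ < δ → ∀ X ∈ L, ∃ c : ℝ → 𝔸, ∃ v ∈ L, c 0 = a ∧
      (∀ᶠ s in 𝓝 (0 : ℝ), c s ∈ L ∧ exp (c s) = exp a * exp (s • X)) ∧
      HasDerivAt c v 0 ∧ exp (-a) * fderiv ℝ exp a v = X := by
  obtain ⟨Q, hQ⟩ := exists_clm_retraction L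
  have hJ := contDiff_expLogDeriv Q
  -- `R` is the set of invertible operators. It is open and contains the value at `0`, which is the
  -- identity; this fixes `δ`.
  set R : Set (L →L[ℝ] L) := Set.range ((↑) : (L ≃L[ℝ] L) → L →L[ℝ] L)
  have hRo : ∀ a : L, expLogDeriv Q a ∈ R → ∀ᶠ b in 𝓝 a, expLogDeriv Q b ∈ R := by
    rintro a ⟨e, he⟩
    apply hJ.continuous.continuousAt.eventually
    rw [← he]
    exact ContinuousLinearEquiv.nhds e
  have h0 : ∀ᶠ b in 𝓝 (0 : L), expLogDeriv Q b ∈ R :=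
    hRo 0 ⟨ContinuousLinearEquiv.refl ℝ L, by rw [expLogDeriv_zero hQ]; rfl⟩
  obtain ⟨δ, hδ, hball⟩ := Metric.eventually_nhds_iff.1 h0
  refine ⟨δ, hδ, fun a ha haδ X hX => ?_⟩
  have haR : expLogDeriv Q ⟨a, ha⟩ ∈ R := hball (by simpa [dist_zero_right] using haδ)
  -- An integral curve `α` of this field satisfies `(exp α)' = exp α * X`. Solving the equation in
  -- `L` itself keeps the lift in `L`.
  set V : L → L := fun b => ContinuousLinearMap.inverse (expLogDeriv Q b) ⟨X, hX⟩ with hV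
  have hVJ : ∀ b, expLogDeriv Q b ∈ R → exp (-(b : 𝔸)) * fderiv ℝ exp (b : 𝔸) (V b) = X := by
    rintro b ⟨e, he⟩
    have h1 : expLogDeriv Q b (V b) = ⟨X, hX⟩ := by
      simp only [hV, ← he, ContinuousLinearMap.inverse_equiv]
      simp
    rw [expLogDeriv_apply] at h1
    -- The compressed vector already lies in `L`, so `Q` does not change it.
    have h2 := hQ ⟨_, exp_neg_mul_fderiv_exp_mem hL b.2 (V b).2⟩
    rw [h1] at h2
    exact (congrArg Subtype.val h2).symm
  have hVc : ContDiffAt ℝ 1 V ⟨a, ha⟩ := by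
    obtain ⟨e, he⟩ := haR
    have h1 : ContDiffAt ℝ 1 ContinuousLinearMap.inverse (expLogDeriv Q ⟨a, ha⟩) := by
      rw [← he]; exact contDiffAt_map_inverse e
    exact (h1.comp _ hJ.contDiffAt).clm_apply contDiffAt_const
  obtain ⟨α, hα0, ε, hε, hα⟩ :=
    hVc.exists_forall_mem_closedBall_exists_eq_forall_mem_Ioo_hasDerivAt₀ 0
  simp only [zero_sub, zero_add] at hα
  have hαc : ContinuousAt α 0 := (hα 0 ⟨by linarith, hε⟩).continuousAt
  have hev : ∀ᶠ t in 𝓝 (0 : ℝ), expLogDeriv Q (α t) ∈ R := by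
    apply hαc.eventually (p := fun b => expLogDeriv Q b ∈ R)
    rw [hα0]
    exact hRo _ haR
  obtain ⟨ε', hε', hball'⟩ := Metric.eventually_nhds_iff_ball.1
    (hev.and (Ioo_mem_nhds (neg_lt_zero.2 hε) hε))
  have hαd : ∀ t ∈ Metric.ball (0 : ℝ) ε', HasDerivAt (fun t => (α t : 𝔸)) (V (α t)) t :=
    fun t ht => L.subtypeL.hasFDerivAt.comp_hasDerivAt t (hα t (hball' t ht).2)
  have hz : ∀ t ∈ Metric.ball (0 : ℝ) ε',
      HasDerivAt (fun t : ℝ => exp (α t : 𝔸) * exp (-(t • X))) 0 t := by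
    intro t ht
    have h1 : HasFDerivAt (exp : 𝔸 → 𝔸) (fderiv ℝ exp (α t : 𝔸)) (α t : 𝔸) :=
      (contDiff_exp_real.differentiable (by simp) _).hasFDerivAt
    have h2 := h1.comp_hasDerivAt t (hαd t ht)
    have h3 : fderiv ℝ exp (α t : 𝔸) (V (α t)) = exp (α t : 𝔸) * X := by
      rw [← hVJ _ (hball' t ht).1, ← mul_assoc, exp_mul_exp_neg, one_mul]
    rw [h3] at h2
    refine (h2.fun_mul (hasDerivAt_exp_neg_smul X t)).congr_deriv ?_
    simp only [Function.comp]
    noncomm_ring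
  have h0mem : (0 : ℝ) ∈ Metric.ball (0 : ℝ) ε' := Metric.mem_ball_self hε'
  refine ⟨fun t => α t, V ⟨a, ha⟩, Subtype.property _, by simp [hα0], ?_, ?_, ?_⟩
  · filter_upwards [Metric.ball_mem_nhds (0 : ℝ) hε'] with s hs
    refine ⟨Subtype.property _, ?_⟩
    have h1 := Metric.isOpen_ball.is_const_of_deriv_eq_zero
      (convex_ball (0 : ℝ) ε').isPreconnected
      (fun t ht => (hz t ht).differentiableAt.differentiableWithinAt)
      (fun t ht => (hz t ht).deriv) hs h0mem
    simp only [hα0, zero_smul, neg_zero, exp_zero, mul_one] at h1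
    rw [← h1, mul_assoc, exp_neg_mul_exp, mul_one]
  · simpa [hα0] using hαd 0 h0mem
  · exact hVJ _ haR

variable (B : 𝔸 →L[ℝ] 𝔸 →L[ℝ] ℝ) (hBn : ∀ x, B x x = ‖x‖ ^ 2) (hBs : ∀ x y, B x y = B y x)
  (hBL : ∀ a ∈ L, ∀ y ∈ L, B a (y * a - a * y) = 0)

include hL hBn hBs hBL in
/-- First variation of the squared norm along `s ↦ exp a * exp (s • X)`. -/
theorem exists_log_curve_right :
    ∃ δ > (0 : ℝ), ∀ a ∈ L, ‖a‖ < δ → ∀ X ∈ L, ∃ c : ℝ → 𝔸, c 0 = a ∧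
      (∀ᶠ s in 𝓝 (0 : ℝ), c s ∈ L ∧ exp (c s) = exp a * exp (s • X)) ∧
      HasDerivAt (fun s => ‖c s‖ ^ 2) (2 * B a X) 0 := by
  obtain ⟨δ, hδ, h⟩ := exists_local_log_curve hL
  refine ⟨δ, hδ, fun a ha haδ X hX => ?_⟩
  obtain ⟨c, v, hv, hc0, hc, hd, hvX⟩ := h a ha haδ X hX
  refine ⟨c, hc0, hc, ?_⟩
  have h1 : HasDerivAt (fun s => B (c s) (c s)) (B v (c 0) + B (c 0) v) 0 := by
    have := (B.hasFDerivAt.comp_hasDerivAt (0 : ℝ) hd).clm_apply hd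
    simpa [Function.comp_def] using this
  have h2 : B a v = B a X := by
    rw [← hvX, apply_exp_neg_mul_fderiv_exp hL ha hv (B a) (hBL a ha)]
  simp only [hBn] at h1
  refine h1.congr_deriv ?_
  rw [hc0, hBs v a, h2]
  ring

include hL hBn hBs hBL in
/-- First variation of the squared norm along `s ↦ exp (-(s • X)) * exp a`. -/
theorem exists_log_curve_left :
    ∃ δ > (0 : ℝ), ∀ a ∈ L, ‖a‖ < δ → ∀ X ∈ L, ∃ c : ℝ → 𝔸, c 0 = a ∧
      (∀ᶠ s in 𝓝 (0 : ℝ), c s ∈ L ∧ exp (c s) = exp (-(s • X)) * exp a) ∧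
      HasDerivAt (fun s => ‖c s‖ ^ 2) (-(2 * B a X)) 0 := by
  obtain ⟨δ, hδ, h⟩ := exists_log_curve_right hL B hBn hBs hBL
  refine ⟨δ, hδ, fun a ha haδ X hX => ?_⟩
  -- Inversion exchanges left and right: `exp (-a) * exp (s • X)` is the inverse of `exp (-(s • X))
  -- * exp a`.
  obtain ⟨c, hc0, hc, hd⟩ := h (-a) (L.neg_mem ha) (by simpa using haδ) X hX
  refine ⟨fun s => -c s, by simp [hc0], ?_, ?_⟩
  · filter_upwards [hc] with s hs
    refine ⟨L.neg_mem hs.1, ?_⟩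
    have h1 := exp_neg_mul_exp (c s)
    rw [hs.2] at h1
    calc exp (-c s) = exp (-c s) * (exp (-a) * (exp (s • X) * exp (-(s • X))) * exp a) := by
          rw [exp_mul_exp_neg, mul_one, exp_neg_mul_exp, mul_one]
      _ = exp (-c s) * (exp (-a) * exp (s • X)) * (exp (-(s • X)) * exp a) := by
          simp only [mul_assoc]
      _ = _ := by rw [h1, one_mul]
  · simpa using hd

end LocalLog

end

noncomputable section

open NormedSpace Filter Topology

/-! ### Ordered products of exponentials. -/

section ExpChain

variable {𝔸 : Type*} [NormedRing 𝔸]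

/-- The product `exp (a 0) * exp (a 1) * ⋯ * exp (a (n - 1))`. -/
def expChain (a : ℕ → 𝔸) : ℕ → 𝔸
  | 0 => 1
  | n + 1 => expChain a n * exp (a n)

theorem expChain_congr {a b : ℕ → 𝔸} {n : ℕ} (h : ∀ i < n, a i = b i) :
    expChain a n = expChain b n := by
  induction n with
  | zero => rfl
  | succ n ih => rw [expChain, expChain, ih fun i hi => h i (by omega), h n (by omega)]

theorem expChain_add (a : ℕ → 𝔸) (n m : ℕ) :
    expChain a (n + m) = expChain a n * expChain (fun i => a (n + i)) m := by
  induction m with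
  | zero => simp [expChain]
  | succ m ih => rw [← add_assoc, expChain, ih, expChain, mul_assoc]

theorem expChain_eq_of_adjacent {a b : ℕ → 𝔸} {i n : ℕ} (hi : i + 2 ≤ n)
    (h : ∀ j, j ≠ i → j ≠ i + 1 → b j = a j)
    (he : exp (b i) * exp (b (i + 1)) = exp (a i) * exp (a (i + 1))) :
    expChain b n = expChain a n := by
  obtain ⟨m, rfl⟩ := Nat.exists_eq_add_of_le hi
  have h1 : expChain b (i + 2) = expChain a (i + 2) := by
    change expChain b i * exp (b i) * exp (b (i + 1)) = expChain a i * exp (a i) * exp (a (i + 1))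
    rw [mul_assoc, mul_assoc, he, expChain_congr fun j hj => h j (by omega) (by omega)]
  rw [expChain_add b (i + 2), expChain_add a (i + 2), h1]
  congr 1
  exact expChain_congr fun j _ => h _ (by omega) (by omega)

variable [NormedAlgebra ℝ 𝔸] [CompleteSpace 𝔸]

theorem exp_add_smul (x : 𝔸) (s t : ℝ) : exp ((s + t) • x) = exp (s • x) * exp (t • x) := by
  let _ := NormedAlgebra.restrictScalars ℚ ℝ 𝔸
  rw [add_smul, exp_add_of_commute (((Commute.refl x).smul_left s).smul_right t)]

theorem expChain_smul (w : ℕ → ℝ) (x : 𝔸) (n : ℕ) :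
    expChain (fun i => w i • x) n = exp ((∑ i ∈ Finset.range n, w i) • x) := by
  induction n with
  | zero => simp [expChain]
  | succ n ih => rw [expChain, ih, Finset.sum_range_succ, exp_add_smul]

theorem continuous_expChain (n : ℕ) : Continuous fun a : ℕ → 𝔸 => expChain a n := by
  induction n with
  | zero => exact continuous_const
  | succ n ih => exact ih.mul (continuous_exp_real.comp (continuous_apply n))

end ExpChain

/-! ### Existence of energy minimizers. -/

section Minimizer

variable {𝔸 : Type*} [NormedRing 𝔸] [NormedAlgebra ℝ 𝔸] [FiniteDimensional ℝ 𝔸] [CompleteSpace 𝔸]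

/-- The discrete energy of a chain with weights `w`. -/
def chainEnergy (w : ℕ → ℝ) (n : ℕ) (a : ℕ → 𝔸) : ℝ :=
  ∑ i ∈ Finset.range n, ‖a i‖ ^ 2 / w i

omit [NormedAlgebra ℝ 𝔸] [FiniteDimensional ℝ 𝔸] [CompleteSpace 𝔸] in
theorem norm_sq_le_mul_chainEnergy {w : ℕ → ℝ} (hw : ∀ i, 0 < w i) {n i : ℕ} (hi : i < n)
    (a : ℕ → 𝔸) : ‖a i‖ ^ 2 ≤ w i * chainEnergy w n a := by
  have h := Finset.single_le_sum (f := fun i => ‖a i‖ ^ 2 / w i)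
    (fun j _ => div_nonneg (sq_nonneg _) (hw j).le) (Finset.mem_range.2 hi)
  have h2 : ‖a i‖ ^ 2 / w i ≤ chainEnergy w n a := h
  rwa [div_le_iff₀ (hw i), mul_comm] at h2

theorem exists_isMinOn_chainEnergy (L : Submodule ℝ 𝔸) (w : ℕ → ℝ) (n : ℕ) (δ : ℝ) (b : ℕ → 𝔸)
    (hb : ∀ i, b i ∈ L) (hbδ : ∀ i, ‖b i‖ ≤ δ) :
    ∃ a : ℕ → 𝔸, (∀ i, a i ∈ L) ∧ expChain a n = expChain b n ∧
      chainEnergy w n a ≤ chainEnergy w n b ∧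
      ∀ c : ℕ → 𝔸, (∀ i, c i ∈ L ∧ ‖c i‖ ≤ δ) → expChain c n = expChain b n →
        chainEnergy w n a ≤ chainEnergy w n c := by
  -- Every coordinate in `ℕ` is confined to a ball of `L`, including those beyond `n`, so that
  -- Tychonoff gives compactness.
  set K : Set (ℕ → 𝔸) := Set.pi Set.univ (fun _ => Metric.closedBall (0 : 𝔸) δ ∩ L) ∩
    {a | expChain a n = expChain b n} with hK
  have : ProperSpace 𝔸 := FiniteDimensional.proper ℝ 𝔸
  have hKc : IsCompact K :=
    (isCompact_univ_pi fun _ =>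
      (isCompact_closedBall (0 : 𝔸) δ).inter_right L.closed_of_finiteDimensional).inter_right
      (isClosed_eq (continuous_expChain n) continuous_const)
  have hEc : Continuous fun a : ℕ → 𝔸 => chainEnergy w n a := by
    unfold chainEnergy
    fun_prop
  have hmem : ∀ c : ℕ → 𝔸, (∀ i, c i ∈ L ∧ ‖c i‖ ≤ δ) → expChain c n = expChain b n → c ∈ K :=
    fun c hc hcn => ⟨fun i _ => ⟨by simpa using (hc i).2, (hc i).1⟩, hcn⟩
  have hbK : b ∈ K := hmem b (fun i => ⟨hb i, hbδ i⟩) rfl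
  obtain ⟨a, haK, hmin⟩ := hKc.exists_isMinOn ⟨b, hbK⟩ hEc.continuousOn
  exact ⟨a, fun i => (haK.1 i trivial).2, haK.2, hmin hbK, fun c hc hcn => hmin (hmem c hc hcn)⟩

end Minimizer

/-! ### Straightening a chain into a single exponential. -/

section Straighten

variable {𝔸 : Type*} [NormedRing 𝔸] [NormedAlgebra ℝ 𝔸] [FiniteDimensional ℝ 𝔸] [CompleteSpace 𝔸]
variable {L : Submodule ℝ 𝔸} (hL : ∀ a ∈ L, ∀ b ∈ L, a * b - b * a ∈ L)
variable (B : 𝔸 →L[ℝ] 𝔸 →L[ℝ] ℝ) (hBn : ∀ x, B x x = ‖x‖ ^ 2) (hBs : ∀ x y, B x y = B y x)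
  (hBL : ∀ a ∈ L, ∀ y ∈ L, B a (y * a - a * y) = 0)

include hL hBn hBs hBL in
/-- A chain of short exponentials can be replaced by a single exponential whose squared norm is
bounded by the total weight times the energy. -/
theorem exists_straightening :
    ∃ δ > (0 : ℝ), ∀ (w : ℕ → ℝ) (n : ℕ) (b : ℕ → 𝔸), (∀ i, 0 < w i) → (∀ i, b i ∈ L) →
      (∀ i, ‖b i‖ ≤ δ) → (∀ i, w i * chainEnergy w n b < δ ^ 2) →
      ∃ C ∈ L, exp C = expChain b n ∧
        ‖C‖ ^ 2 ≤ (∑ i ∈ Finset.range n, w i) * chainEnergy w n b := by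
  obtain ⟨δ₁, hδ₁, hright⟩ := exists_log_curve_right hL B hBn hBs hBL
  obtain ⟨δ₂, hδ₂, hleft⟩ := exists_log_curve_left hL B hBn hBs hBL
  refine ⟨min δ₁ δ₂, lt_min hδ₁ hδ₂, ?_⟩
  set δ := min δ₁ δ₂
  have hδ : 0 < δ := lt_min hδ₁ hδ₂
  intro w n b hw hb hbδ hbE
  obtain ⟨a₀, ha₀L, ha₀n, ha₀E, ha₀min⟩ := exists_isMinOn_chainEnergy L w n δ b hb hbδ
  -- entries beyond `n` are irrelevant
  set a : ℕ → 𝔸 := fun i => if i < n then a₀ i else 0 with ha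
  have haa : ∀ i < n, a i = a₀ i := fun i hi => by simp [ha, hi]
  have hEa : chainEnergy w n a = chainEnergy w n a₀ :=
    Finset.sum_congr rfl fun i hi => by rw [haa i (Finset.mem_range.1 hi)]
  have haL : ∀ i, a i ∈ L := fun i => by
    by_cases hi : i < n
    · simpa [ha, hi] using ha₀L i
    · simp [ha, hi]
  have han : expChain a n = expChain b n := (expChain_congr haa).trans ha₀n
  have haE : chainEnergy w n a ≤ chainEnergy w n b := hEa ▸ ha₀E
  -- The energy bound puts the minimizer strictly inside the ball, so small perturbations remain
  -- admissible.
  have haδ : ∀ i, ‖a i‖ < δ := by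
    intro i
    by_cases hi : i < n
    · have h1 := norm_sq_le_mul_chainEnergy hw hi a
      have h2 := mul_le_mul_of_nonneg_left haE (hw i).le
      exact lt_of_pow_lt_pow_left₀ 2 hδ.le ((h1.trans h2).trans_lt (hbE i))
    · simpa [ha, hi] using hδ
  have hstep : ∀ i, i + 2 ≤ n → (w i)⁻¹ • a i = (w (i + 1))⁻¹ • a (i + 1) := by
    intro i hi
    -- The jump in velocity between neighbours. Inserting `exp (s • X) * exp (-(s • X))` between
    -- them preserves the product and changes the energy at rate `2 * B X X = 2 * ‖X‖ ^ 2`, so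
    -- minimality forces `X = 0`.
    set X : 𝔸 := (w i)⁻¹ • a i - (w (i + 1))⁻¹ • a (i + 1) with hX
    have hXL : X ∈ L := L.sub_mem (L.smul_mem _ (haL _)) (L.smul_mem _ (haL _))
    obtain ⟨c, hc0, hc, hcd⟩ := hright (a i) (haL i) ((haδ i).trans_le (min_le_left _ _)) X hXL
    obtain ⟨d, hd0, hd, hdd⟩ :=
      hleft (a (i + 1)) (haL _) ((haδ _).trans_le (min_le_right _ _)) X hXL
    set ψ : ℝ → ℝ := fun s => ‖c s‖ ^ 2 / w i + ‖d s‖ ^ 2 / w (i + 1) with hψ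
    have hψd : HasDerivAt ψ (2 * B X X) 0 := by
      refine ((hcd.div_const (w i)).add (hdd.div_const (w (i + 1)))).congr_deriv ?_
      have hXX : B X X = (w i)⁻¹ * B (a i) X - (w (i + 1))⁻¹ * B (a (i + 1)) X := by
        change B ((w i)⁻¹ • a i - (w (i + 1))⁻¹ • a (i + 1)) X = _
        simp
      rw [hXX]
      ring
    have hcδ : ∀ᶠ s in 𝓝 (0 : ℝ), ‖c s‖ ^ 2 < δ ^ 2 :=
      hcd.continuousAt.eventually_lt continuousAt_const
        (by simpa [hc0] using pow_lt_pow_left₀ (haδ i) (norm_nonneg _) two_ne_zero)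
    have hdδ : ∀ᶠ s in 𝓝 (0 : ℝ), ‖d s‖ ^ 2 < δ ^ 2 :=
      hdd.continuousAt.eventually_lt continuousAt_const
        (by simpa [hd0] using pow_lt_pow_left₀ (haδ (i + 1)) (norm_nonneg _) two_ne_zero)
    have hmin : IsLocalMin ψ 0 := by
      filter_upwards [hc, hd, hcδ, hdδ] with s hcs hds hcδs hdδs
      set e : ℕ → 𝔸 := Function.update (Function.update a i (c s)) (i + 1) (d s) with he
      have hei : e i = c s := by simp [he]
      have hei1 : e (i + 1) = d s := by simp [he]
      have hej : ∀ j, j ≠ i → j ≠ i + 1 → e j = a j := fun j h1 h2 => by simp [he, h1, h2]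
      have h1 := ha₀min e
        (fun j => by
          by_cases h1 : j = i
          · subst h1
            rw [hei]
            exact ⟨hcs.1, (lt_of_pow_lt_pow_left₀ 2 hδ.le hcδs).le⟩
          by_cases h2 : j = i + 1
          · subst h2
            rw [hei1]
            exact ⟨hds.1, (lt_of_pow_lt_pow_left₀ 2 hδ.le hdδs).le⟩
          rw [hej j h1 h2]
          exact ⟨haL j, (haδ j).le⟩)
        (by
          rw [← han]
          refine expChain_eq_of_adjacent hi hej ?_
          rw [hei, hei1, hcs.2, hds.2]
          calc exp (a i) * exp (s • X) * (exp (-(s • X)) * exp (a (i + 1)))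
              = exp (a i) * (exp (s • X) * exp (-(s • X))) * exp (a (i + 1)) := by
                simp only [mul_assoc]
            _ = _ := by rw [exp_mul_exp_neg, mul_one])
      rw [← hEa] at h1
      have h2 : chainEnergy w n e - chainEnergy w n a = ψ s - ψ 0 := by
        unfold chainEnergy
        rw [← Finset.sum_sub_distrib, Finset.sum_eq_add_of_mem i (i + 1)
          (Finset.mem_range.2 (by omega)) (Finset.mem_range.2 (by omega)) (by omega)]
        · rw [hei, hei1]
          simp only [hψ, hc0, hd0]
          ring
        · intro j _ hj
          rw [hej j hj.1 hj.2, sub_self]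
      linarith
    have h0 := hmin.hasDerivAt_eq_zero hψd
    rw [hBn] at h0
    have : X = 0 := by
      have : ‖X‖ ^ 2 = 0 := by linarith
      simpa using this
    exact sub_eq_zero.1 this
  set A : 𝔸 := (w 0)⁻¹ • a 0 with hA
  have haA : ∀ i < n, a i = w i • A := by
    have key : ∀ i, i < n → (w i)⁻¹ • a i = A := by
      intro i
      induction i with
      | zero => exact fun _ => rfl
      | succ i ih => exact fun hi => (hstep i hi).symm.trans (ih (by omega))
    intro i hi
    rw [← key i hi, smul_smul, mul_inv_cancel₀ (hw i).ne', one_smul]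
  refine ⟨(∑ i ∈ Finset.range n, w i) • A, L.smul_mem _ (L.smul_mem _ (haL 0)), ?_, ?_⟩
  · rw [← expChain_smul, ← han]
    exact (expChain_congr haA).symm
  · have hW : 0 ≤ ∑ i ∈ Finset.range n, w i := Finset.sum_nonneg fun i _ => (hw i).le
    -- Equality case of Cauchy–Schwarz: at constant velocity the squared length is total weight
    -- times energy.
    have hEA : chainEnergy w n a = (∑ i ∈ Finset.range n, w i) * ‖A‖ ^ 2 := by
      unfold chainEnergy
      rw [Finset.sum_mul]
      refine Finset.sum_congr rfl fun i hi => ?_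
      rw [haA i (Finset.mem_range.1 hi), norm_smul, Real.norm_of_nonneg (hw i).le]
      field_simp [(hw i).ne']
    rw [norm_smul, Real.norm_of_nonneg hW, mul_pow]
    calc _ = (∑ i ∈ Finset.range n, w i) * chainEnergy w n a := by rw [hEA]; ring
      _ ≤ _ := mul_le_mul_of_nonneg_left haE hW

include hL hBn hBs hBL in
/-- The product of two exponentials is an exponential of norm at most the sum of the norms. -/
theorem exists_exp_eq_exp_mul_exp {a b : 𝔸} (ha : a ∈ L) (hb : b ∈ L) :
    ∃ C ∈ L, exp C = exp a * exp b ∧ ‖C‖ ≤ ‖a‖ + ‖b‖ := by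
  rcases eq_or_ne a 0 with rfl | ha0
  · exact ⟨b, hb, by simp, by simp⟩
  rcases eq_or_ne b 0 with rfl | hb0
  · exact ⟨a, ha, by simp, by simp⟩
  obtain ⟨δ, hδ, h⟩ := exists_straightening hL B hBn hBs hBL
  have hna : 0 < ‖a‖ := norm_pos_iff.2 ha0
  have hnb : 0 < ‖b‖ := norm_pos_iff.2 hb0
  set W := ‖a‖ + ‖b‖ with hW
  -- The two bounds ensure that pieces of norm at most `W / k` satisfy the smallness conditions `W /
  -- k ≤ δ` and `(W / k) * W < δ ^ 2`.
  obtain ⟨k, hk⟩ := exists_nat_gt (max (W / δ) (W * W / δ ^ 2))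
  have hk1 := (le_max_left _ _).trans_lt hk
  have hk2 := (le_max_right _ _).trans_lt hk
  have hkpos : (0 : ℝ) < k := lt_of_le_of_lt (by positivity) hk1
  rw [div_lt_iff₀ hδ] at hk1
  rw [div_lt_iff₀ (by positivity)] at hk2
  set f : ℕ → 𝔸 := fun i => (k : ℝ)⁻¹ • if i < k then a else b with hf
  -- Taking the norms of the pieces as weights makes both total weight and energy equal to `W`; the
  -- weights are positive because `a` and `b` are nonzero.
  set w : ℕ → ℝ := fun i => (k : ℝ)⁻¹ * if i < k then ‖a‖ else ‖b‖ with hw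
  have hfw : ∀ i, ‖f i‖ = w i := fun i => by
    simp only [hf, hw, norm_smul, norm_inv, RCLike.norm_natCast]
    split_ifs <;> rfl
  have hwpos : ∀ i, 0 < w i := fun i => by
    simp only [hw]
    split_ifs <;> positivity
  have hwle : ∀ i, w i ≤ (k : ℝ)⁻¹ * W := fun i => by
    simp only [hw]
    apply mul_le_mul_of_nonneg_left _ (by positivity)
    split_ifs <;> linarith
  have hsum : ∑ i ∈ Finset.range (k + k), w i = W := by
    rw [Finset.sum_range_add]
    have h1 : ∑ i ∈ Finset.range k, w i = ‖a‖ := by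
      rw [Finset.sum_congr rfl fun i hi => show w i = (k : ℝ)⁻¹ * ‖a‖ by
        simp [hw, Finset.mem_range.1 hi]]
      simp [hkpos.ne']
    have h2 : ∑ i ∈ Finset.range k, w (k + i) = ‖b‖ := by
      simp [hw, hkpos.ne']
    rw [h1, h2]
  have hE : chainEnergy w (k + k) f = W := by
    rw [← hsum]
    refine Finset.sum_congr rfl fun i _ => ?_
    rw [hfw, sq, mul_div_assoc, div_self (hwpos i).ne', mul_one]
  obtain ⟨C, hC, hCe, hCn⟩ := h w (k + k) f hwpos
    (fun i => L.smul_mem _ (by split_ifs <;> assumption))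
    (fun i => by
      rw [hfw]
      refine (hwle i).trans ?_
      rw [inv_mul_le_iff₀ hkpos]
      exact hk1.le)
    (fun i => by
      rw [hE]
      refine (mul_le_mul_of_nonneg_right (hwle i) (by positivity)).trans_lt ?_
      rw [mul_assoc, inv_mul_lt_iff₀ hkpos]
      exact hk2)
  refine ⟨C, hC, ?_, ?_⟩
  · rw [hCe, expChain_add]
    congr 1
    · rw [expChain_congr (b := fun _ => (k : ℝ)⁻¹ • a) fun i hi => by simp [hf, hi]]
      rw [expChain_smul (fun _ => (k : ℝ)⁻¹)]
      simp [hkpos.ne']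
    · rw [expChain_congr (b := fun _ => (k : ℝ)⁻¹ • b) fun i hi => by simp [hf]]
      rw [expChain_smul (fun _ => (k : ℝ)⁻¹)]
      simp [hkpos.ne']
  · rw [hsum, hE, ← sq] at hCn
    exact le_of_sq_le_sq hCn (by positivity)

end Straighten

end

noncomputable section

open NormedSpace Filter Topology

/-! ### Product-integral approximation of the evolution. -/

section ProductIntegral

open MeasureTheory Set

variable {𝔸 : Type*} [NormedRing 𝔸] [NormedAlgebra ℝ 𝔸] [FiniteDimensional ℝ 𝔸] [CompleteSpace 𝔸]
variable {L : Submodule ℝ 𝔸}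

omit [FiniteDimensional ℝ 𝔸] in
theorem exists_norm_exp_sub_one_sub_le {ρ : ℝ} (hρ : 0 < ρ) :
    ∃ η > (0 : ℝ), ∀ a : 𝔸, ‖a‖ < η → ‖exp a - 1 - a‖ ≤ ρ * ‖a‖ := by
  have h := (hasFDerivAt_exp_zero (𝕂 := ℝ) (𝔸 := 𝔸)).isLittleO.def hρ
  obtain ⟨η, hη, h⟩ := Metric.eventually_nhds_iff.1 h
  refine ⟨η, hη, fun a ha => ?_⟩
  simpa using h (y := a) (by simpa using ha)

variable {F U : ℝ → 𝔸} {T K : ℝ} (hFL : ∀ t ∈ Icc 0 T, F t ∈ L)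
  (hFK : ∀ t ∈ Icc 0 T, ‖F t‖ ≤ K) (hFi : IntegrableOn F (Icc 0 T))
  (hUc : ContinuousOn U (Icc 0 T)) {S : Set ℝ} (hS : S.Countable)
  (hUd : ∀ t ∈ Ioo 0 T \ S, HasDerivAt U (F t * U t) t)

include hFL hFK hFi hUc hS hUd in
-- One step of an exponential Euler scheme with exponent `∫ F`. The error is `o(t - s)` uniformly in
-- `s`, and the growth factor is what a discrete Grönwall estimate needs.
theorem exists_exp_step {ε : ℝ} (hε : 0 < ε) :
    ∃ η > (0 : ℝ), ∀ s t : ℝ, 0 ≤ s → s ≤ t → t ≤ T → t - s < η →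
      ∃ a ∈ L, ‖a‖ ≤ (∫ r in s..t, ‖F r‖) ∧ ‖U t - exp a * U s‖ ≤ ε * (t - s) ∧
        ∀ y, ‖exp a * y‖ ≤ (1 + 2 * K * (t - s)) * ‖y‖ := by
  rcases lt_or_ge T 0 with hT | hT
  · exact ⟨1, one_pos, fun s t h1 h2 h3 _ => by linarith⟩
  have hK : 0 ≤ K := (norm_nonneg _).trans (hFK 0 ⟨le_rfl, hT⟩)
  obtain ⟨M, hM⟩ := isCompact_Icc.exists_bound_of_continuousOn hUc
  have hM0 : 0 ≤ M := (norm_nonneg _).trans (hM 0 ⟨le_rfl, hT⟩)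
  -- `ω` bounds the oscillation of `U` on a step and `ρ` the relative remainder of `exp a - 1 - a`;
  -- each contributes at most `ε / 2` per unit time. The `1` in the minimum yields `‖exp a - 1‖ ≤ 2
  -- * ‖a‖`.
  set ω : ℝ := ε / (2 * (K + 1)) with hω
  have hωpos : 0 < ω := by positivity
  set ρ : ℝ := min 1 (ε / (2 * (K + 1) * (M + 1))) with hρ
  have hρpos : 0 < ρ := lt_min one_pos (by positivity)
  obtain ⟨η₁, hη₁, hexp⟩ := exists_norm_exp_sub_one_sub_le (𝔸 := 𝔸) hρpos
  obtain ⟨η₂, hη₂, hunif⟩ := Metric.uniformContinuousOn_iff.1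
    (isCompact_Icc.uniformContinuousOn_of_continuous hUc) ω hωpos
  refine ⟨min (η₁ / (K + 1)) η₂, lt_min (by positivity) hη₂, fun s t hs hst ht hη => ?_⟩
  have hsub : Icc s t ⊆ Icc 0 T := Icc_subset_Icc hs ht
  have hsubu : uIcc s t ⊆ Icc 0 T := by rwa [uIcc_of_le hst]
  have hFst : IntervalIntegrable F volume s t :=
    (intervalIntegrable_iff_integrableOn_Icc_of_le hst).2 (hFi.mono_set hsub)
  have hFUst : IntervalIntegrable (fun r => F r * U r) volume s t :=
    hFst.mul_continuousOn (hUc.mono hsubu)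
  have hFcst : IntervalIntegrable (fun r => F r * U s) volume s t :=
    hFst.mul_continuousOn continuousOn_const
  have hts : 0 ≤ t - s := sub_nonneg.2 hst
  set a : 𝔸 := ∫ r in s..t, F r with ha
  have haL : a ∈ L :=
    intervalIntegral_mem_submodule L hst (fun r hr => hFL r (hsub hr)) hFst
  have haF : ‖a‖ ≤ ∫ r in s..t, ‖F r‖ := intervalIntegral.norm_integral_le_integral_norm hst
  have hIoc : ∀ r ∈ uIoc s t, r ∈ Icc s t := fun r hr => by
    rw [uIoc_of_le hst] at hr
    exact Ioc_subset_Icc_self hr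
  have haK : ‖a‖ ≤ K * (t - s) := by
    have := intervalIntegral.norm_integral_le_of_norm_le_const (a := s) (b := t) (f := F) (C := K)
      fun r hr => hFK r (hsub (hIoc r hr))
    rwa [abs_of_nonneg hts] at this
  have haη : ‖a‖ < η₁ := by
    have h1 := hη.trans_le (min_le_left _ _)
    rw [lt_div_iff₀ (by positivity)] at h1
    nlinarith
  have hea := hexp a haη
  have hFTC : ∫ r in s..t, F r * U r = U t - U s :=
    integral_eq_of_hasDerivAt_off_countable_of_le U _ hst hS (hUc.mono hsub)
      (fun r hr => hUd r ⟨Ioo_subset_Ioo hs ht hr.1, hr.2⟩) hFUst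
  have hdecomp : U t - exp a * U s =
      (∫ r in s..t, F r * (U r - U s)) - (exp a - 1 - a) * U s := by
    have h1 : ∫ r in s..t, F r * (U r - U s) = (U t - U s) - a * U s := by
      simp only [mul_sub]
      rw [intervalIntegral.integral_sub hFUst hFcst, hFTC]
      congr 1
      exact ((ContinuousLinearMap.mul ℝ 𝔸).flip (U s)).intervalIntegral_comp_comm hFst
    rw [h1]
    noncomm_ring
  have hfirst : ‖∫ r in s..t, F r * (U r - U s)‖ ≤ K * ω * (t - s) := by
    have := intervalIntegral.norm_integral_le_of_norm_le_const (a := s) (b := t)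
      (f := fun r => F r * (U r - U s)) (C := K * ω) fun r hr => by
        have hr := hIoc r hr
        refine (norm_mul_le _ _).trans (mul_le_mul (hFK r (hsub hr)) ?_ (norm_nonneg _) hK)
        rw [← dist_eq_norm]
        refine (hunif r (hsub hr) s (hsub ⟨le_rfl, hst⟩) ?_).le
        rw [Real.dist_eq, abs_of_nonneg (by linarith [hr.1])]
        linarith [hr.2, hη.trans_le (min_le_right _ _)]
    rwa [abs_of_nonneg hts] at this
  have hsecond : ‖(exp a - 1 - a) * U s‖ ≤ ρ * (K * (t - s)) * M :=
    (norm_mul_le _ _).trans (mul_le_mul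
      (hea.trans (mul_le_mul_of_nonneg_left haK hρpos.le)) (hM s (hsub ⟨le_rfl, hst⟩))
      (norm_nonneg _) (by positivity))
  refine ⟨a, haL, haF, ?_, fun y => ?_⟩
  · rw [hdecomp]
    refine (norm_sub_le _ _).trans ((add_le_add hfirst hsecond).trans ?_)
    have h1 : K * ω ≤ ε / 2 := by
      rw [hω, mul_div_assoc', div_le_div_iff₀ (by positivity) two_pos]
      nlinarith
    have h2 : ρ * K * M ≤ ε / 2 := by
      have h3 : ρ * (K * M) ≤ ε / (2 * (K + 1) * (M + 1)) * ((K + 1) * (M + 1)) :=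
        mul_le_mul (min_le_right _ _) (by nlinarith) (by positivity) (by positivity)
      have h4 : ε / (2 * (K + 1) * (M + 1)) * ((K + 1) * (M + 1)) = ε / 2 := by
        field_simp
      linarith
    calc K * ω * (t - s) + ρ * (K * (t - s)) * M = (K * ω + ρ * K * M) * (t - s) := by ring
      _ ≤ _ := mul_le_mul_of_nonneg_right (by linarith) hts
  · have h1 : ‖exp a - 1‖ ≤ 2 * (K * (t - s)) := by
      have h2 : exp a - 1 = (exp a - 1 - a) + a := by abel
      rw [h2]
      refine (norm_add_le _ _).trans ?_
      have h3 : ρ * ‖a‖ ≤ 1 * ‖a‖ := mul_le_mul_of_nonneg_right (min_le_left _ _) (norm_nonneg _)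
      linarith
    have h2 : exp a * y = y + (exp a - 1) * y := by noncomm_ring
    rw [h2]
    refine (norm_add_le _ _).trans ?_
    have h3 := (norm_mul_le (exp a - 1) y).trans (mul_le_mul_of_nonneg_right h1 (norm_nonneg y))
    linarith

variable (hL : ∀ a ∈ L, ∀ b ∈ L, a * b - b * a ∈ L)
variable (B : 𝔸 →L[ℝ] 𝔸 →L[ℝ] ℝ) (hBn : ∀ x, B x x = ‖x‖ ^ 2) (hBs : ∀ x y, B x y = B y x)
  (hBL : ∀ a ∈ L, ∀ y ∈ L, B a (y * a - a * y) = 0)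

include hFL hFK hFi hUc hS hUd hL hBn hBs hBL in
/-- The endpoint of a path with velocity in `L` is approximated by single exponentials. -/
theorem exists_exp_near_endpoint (hT : 0 ≤ T) (hU0 : U 0 = 1) {ε : ℝ} (hε : 0 < ε) :
    ∃ C ∈ L, ‖C‖ ≤ (∫ r in (0 : ℝ)..T, ‖F r‖) ∧
      ‖U T - exp C‖ ≤ ε * (T * Real.exp (2 * K * T)) := by
  have hK : 0 ≤ K := (norm_nonneg _).trans (hFK 0 ⟨le_rfl, hT⟩)
  obtain ⟨η, hη, hstep⟩ := exists_exp_step hFL hFK hFi hUc hS hUd hε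
  have hii : ∀ s t, 0 ≤ s → s ≤ t → t ≤ T → IntervalIntegrable (fun r => ‖F r‖) volume s t :=
    fun s t h1 h2 h3 => ((intervalIntegrable_iff_integrableOn_Icc_of_le h2).2
      (hFi.mono_set (Icc_subset_Icc h1 h3))).norm
  -- Each new factor is merged at once into a single exponential, so norms add along the path while
  -- the error obeys the Grönwall bound.
  have hind : ∀ s t : ℝ, 0 ≤ s → s ≤ t → t ≤ T → t - s < η →
      (∃ C ∈ L, ‖C‖ ≤ (∫ r in (0 : ℝ)..s, ‖F r‖) ∧
        ‖U s - exp C‖ ≤ ε * (s * Real.exp (2 * K * s))) →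
      ∃ C ∈ L, ‖C‖ ≤ (∫ r in (0 : ℝ)..t, ‖F r‖) ∧
        ‖U t - exp C‖ ≤ ε * (t * Real.exp (2 * K * t)) := by
    rintro s t hs hst ht hη' ⟨C, hC, hCn, hCU⟩
    obtain ⟨a, ha, han, haU, hay⟩ := hstep s t hs hst ht hη'
    obtain ⟨C', hC', hC'e, hC'n⟩ := exists_exp_eq_exp_mul_exp hL B hBn hBs hBL ha hC
    have hts : 0 ≤ t - s := sub_nonneg.2 hst
    refine ⟨C', hC', ?_, ?_⟩
    · rw [← intervalIntegral.integral_add_adjacent_intervals (hii 0 s le_rfl hs (hst.trans ht))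
        (hii s t hs hst ht)]
      linarith
    · have h1 : U t - exp C' = (U t - exp a * U s) + exp a * (U s - exp C) := by
        rw [hC'e]
        noncomm_ring
      rw [h1]
      have h2 : 1 + 2 * K * (t - s) ≤ Real.exp (2 * K * (t - s)) := by
        linarith [Real.add_one_le_exp (2 * K * (t - s))]
      have h3 : ‖exp a * (U s - exp C)‖ ≤ ε * (s * Real.exp (2 * K * t)) := by
        refine (hay _).trans ((mul_le_mul h2 hCU (norm_nonneg _) (Real.exp_pos _).le).trans_eq ?_)
        have : Real.exp (2 * K * t) = Real.exp (2 * K * (t - s)) * Real.exp (2 * K * s) := by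
          rw [← Real.exp_add]
          ring_nf
        rw [this]
        ring
      have h4 : (1 : ℝ) ≤ Real.exp (2 * K * t) :=
        Real.one_le_exp (mul_nonneg (by positivity) (hs.trans hst))
      have h5 : ε * (t - s) ≤ ε * (t - s) * Real.exp (2 * K * t) :=
        le_mul_of_one_le_right (by positivity) h4
      refine (norm_add_le _ _).trans ((add_le_add (haU.trans h5) h3).trans_eq ?_)
      ring
  obtain ⟨N, hN⟩ := exists_nat_gt (T / η)
  have hNpos : (0 : ℝ) < N := lt_of_le_of_lt (by positivity) hN
  have hΔ : T / N < η := by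
    rw [div_lt_iff₀ hη] at hN
    rw [div_lt_iff₀ hNpos]
    linarith
  have hall : ∀ k : ℕ, k ≤ N → ∃ C ∈ L, ‖C‖ ≤ (∫ r in (0 : ℝ)..(k * (T / N)), ‖F r‖) ∧
      ‖U (k * (T / N)) - exp C‖ ≤ ε * ((k * (T / N)) * Real.exp (2 * K * (k * (T / N)))) := by
    intro k
    induction k with
    | zero => exact fun _ => ⟨0, L.zero_mem, by simp, by simp [hU0]⟩
    | succ k ih =>
      intro hk
      have hd : (0 : ℝ) ≤ T / N := by positivity
      refine hind (k * (T / N)) _ (by positivity) ?_ ?_ ?_ (ih (by omega))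
      · push_cast
        linarith
      · have : ((k + 1 : ℕ) : ℝ) ≤ N := by exact_mod_cast hk
        calc ((k + 1 : ℕ) : ℝ) * (T / N) ≤ N * (T / N) := mul_le_mul_of_nonneg_right this hd
          _ = T := by field_simp
      · push_cast
        linarith
  have := hall N le_rfl
  rwa [mul_div_cancel₀ T hNpos.ne'] at this

include hFL hFK hFi hUc hS hUd hL hBn hBs hBL in
/-- The endpoint of a path with velocity in `L` is the exponential of an element of `L` of norm at
most the length of the path. -/
theorem exists_exp_eq_endpoint (hT : 0 ≤ T) (hU0 : U 0 = 1) :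
    ∃ C ∈ L, exp C = U T ∧ ‖C‖ ≤ ∫ r in (0 : ℝ)..T, ‖F r‖ := by
  have : ProperSpace 𝔸 := FiniteDimensional.proper ℝ 𝔸
  set R := ∫ r in (0 : ℝ)..T, ‖F r‖ with hR
  have hcomp : IsCompact (Metric.closedBall (0 : 𝔸) R ∩ L) :=
    (isCompact_closedBall _ _).inter_right L.closed_of_finiteDimensional
  -- The image of a compact ball of `L` is closed, so the approximate endpoints yield an exact one
  -- with the same norm bound.
  have hclosed : IsClosed (exp '' (Metric.closedBall (0 : 𝔸) R ∩ L)) :=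
    (hcomp.image continuous_exp_real).isClosed
  have hmem : U T ∈ closure (exp '' (Metric.closedBall (0 : 𝔸) R ∩ L)) := by
    rw [Metric.mem_closure_iff]
    intro e he
    set D := T * Real.exp (2 * K * T) with hD
    have hDnn : 0 ≤ D := mul_nonneg hT (Real.exp_pos _).le
    obtain ⟨C, hC, hCn, hCU⟩ := exists_exp_near_endpoint hFL hFK hFi hUc hS hUd hL B hBn hBs hBL
      hT hU0 (ε := e / (2 * (D + 1))) (by positivity)
    refine ⟨exp C, ⟨C, ⟨by simpa using hCn, hC⟩, rfl⟩, ?_⟩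
    rw [dist_eq_norm]
    refine hCU.trans_lt ?_
    rw [← hD, div_mul_eq_mul_div, div_lt_iff₀ (by positivity)]
    nlinarith
  rw [hclosed.closure_eq] at hmem
  obtain ⟨C, ⟨hCn, hC⟩, hCe⟩ := hmem
  exact ⟨C, hC, hCe, by simpa using hCn⟩

end ProductIntegral

end

noncomputable section

/-! ### Integrability of bounded piecewise continuous functions. -/

section BoundedIntegrable

open MeasureTheory Set

theorem integrableOn_Icc_of_bounded_of_continuousOn_diff_finite {E : Type*} [NormedAddCommGroup E]
    {F : ℝ → E} {a b K : ℝ} {S : Set ℝ} (hK : ∀ t ∈ Icc a b, ‖F t‖ ≤ K) (hS : S.Finite)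
    (hc : ContinuousOn F (Icc a b \ S)) : IntegrableOn F (Icc a b) := by
  have hmeas : MeasurableSet (Icc a b \ S) := measurableSet_Icc.diff hS.measurableSet
  have h1 : IntegrableOn F (Icc a b \ S) := by
    refine IntegrableOn.of_bound ((measure_mono sdiff_subset).trans_lt measure_Icc_lt_top)
      (hc.aestronglyMeasurable hmeas) K ?_
    filter_upwards [ae_restrict_mem hmeas] with t ht
    exact hK t ht.1
  exact h1.congr_set_ae (sdiff_null_ae_eq_self (hS.measure_zero volume)).symm

end BoundedIntegrable

/-! ### Skew-Hermitian matrices with the Frobenius norm. -/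

section MatrixApplication

open MeasureTheory Set

attribute [local instance 100] LieRing.ofAssociativeRing
attribute [local instance] Matrix.frobeniusNormedRing Matrix.frobeniusNormedAlgebra
  Matrix.frobeniusNormedAddCommGroup Matrix.frobeniusNormedSpace

variable {D M : ℕ}

/-- The real bilinear form `(A, B) ↦ Re tr (A† B)`. -/
def frobeniusForm : Matrix (Fin D) (Fin D) ℂ →L[ℝ] Matrix (Fin D) (Fin D) ℂ →L[ℝ] ℝ :=
  LinearMap.toContinuousLinearMap (LinearMap.toContinuousLinearMap.toLinearMap ∘ₗ
    LinearMap.mk₂ ℝ (fun A B : Matrix (Fin D) (Fin D) ℂ => (A.conjTranspose * B).trace.re)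
      (fun A A' B => by simp [Matrix.add_mul])
      (fun c A B => by simp [Matrix.trace_smul])
      (fun A B B' => by simp [Matrix.mul_add])
      (fun c A B => by simp [Matrix.trace_smul]))

theorem frobeniusForm_apply (A B : Matrix (Fin D) (Fin D) ℂ) :
    frobeniusForm A B = (A.conjTranspose * B).trace.re := rfl

theorem frobeniusForm_self (A : Matrix (Fin D) (Fin D) ℂ) : frobeniusForm A A = ‖A‖ ^ 2 := by
  rw [frobeniusForm_apply, Matrix.frobenius_norm_def, ← Real.sqrt_eq_rpow, Real.sq_sqrt
    (Finset.sum_nonneg fun i _ => Finset.sum_nonneg fun j _ => by positivity)]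
  simp only [Matrix.trace, Matrix.diag, Matrix.mul_apply, Matrix.conjTranspose_apply,
    Complex.re_sum]
  rw [Finset.sum_comm]
  refine Finset.sum_congr rfl fun i _ => Finset.sum_congr rfl fun j _ => ?_
  rw [Real.rpow_two, Complex.sq_norm, Complex.normSq_apply]
  simp

theorem frobeniusForm_comm (A B : Matrix (Fin D) (Fin D) ℂ) :
    frobeniusForm A B = frobeniusForm B A := by
  rw [frobeniusForm_apply, frobeniusForm_apply]
  have : (B.conjTranspose * A).trace = star (A.conjTranspose * B).trace := by
    rw [← Matrix.trace_conjTranspose, Matrix.conjTranspose_mul, Matrix.conjTranspose_conjTranspose]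
  rw [this]
  simp

/-- Cyclicity of the trace; skewness of `A` turns `A†` into `-A`, so both products have the same
trace. -/
theorem frobeniusForm_commutator {A : Matrix (Fin D) (Fin D) ℂ} (hA : A.conjTranspose = -A)
    (Y : Matrix (Fin D) (Fin D) ℂ) : frobeniusForm A (Y * A - A * Y) = 0 := by
  have : (A * (Y * A)).trace = (A * (A * Y)).trace := by
    rw [← Matrix.mul_assoc, Matrix.trace_mul_comm]
  simp [frobeniusForm_apply, hA, Matrix.mul_sub, this]

theorem frobeniusNorm_eq_norm (A : Matrix (Fin D) (Fin D) ℂ) : frobeniusNorm A = ‖A‖ := by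
  rw [frobeniusNorm, ← frobeniusForm_apply, frobeniusForm_self, Real.sqrt_sq (norm_nonneg A)]

theorem conjTranspose_eq_neg_of_mem_dynamicalLieAlgebra
    {H : Fin (M + 1) → Matrix (Fin D) (Fin D) ℂ} (hH : ∀ m, (H m).IsHermitian)
    {A : Matrix (Fin D) (Fin D) ℂ} (hA : A ∈ dynamicalLieAlgebra H) : A.conjTranspose = -A := by
  let K : LieSubalgebra ℝ (Matrix (Fin D) (Fin D) ℂ) :=
    { carrier := {A | A.conjTranspose = -A}
      add_mem' := fun {A B} hA hB => by
        simp only [mem_ofPred_eq] at *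
        rw [Matrix.conjTranspose_add, hA, hB, neg_add]
      zero_mem' := by simp
      smul_mem' := fun c A hA => by
        simp only [mem_ofPred_eq] at *
        rw [Matrix.conjTranspose_smul, hA, star_trivial, smul_neg]
      lie_mem' := fun {A B} hA hB => by
        change (⁅A, B⁆).conjTranspose = -⁅A, B⁆
        change A.conjTranspose = -A at hA
        change B.conjTranspose = -B at hB
        rw [LieRing.of_associative_ring_bracket, Matrix.conjTranspose_sub,
          Matrix.conjTranspose_mul, Matrix.conjTranspose_mul, hA, hB]
        noncomm_ring }
  have hle : dynamicalLieAlgebra H ≤ K := by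
    apply LieSubalgebra.lieSpan_le.2
    rintro _ ⟨m, rfl⟩
    change (Complex.I • H m).conjTranspose = -(Complex.I • H m)
    rw [Matrix.conjTranspose_smul, (hH m).eq]
    simp
  exact hle hA

theorem commutator_mem_dynamicalLieAlgebra {H : Fin (M + 1) → Matrix (Fin D) (Fin D) ℂ}
    {A B : Matrix (Fin D) (Fin D) ℂ} (hA : A ∈ dynamicalLieAlgebra H)
    (hB : B ∈ dynamicalLieAlgebra H) : A * B - B * A ∈ dynamicalLieAlgebra H := by
  have := (dynamicalLieAlgebra H).lie_mem hA hB
  rwa [LieRing.of_associative_ring_bracket] at this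

theorem I_smul_hamiltonian_mem (H : Fin (M + 1) → Matrix (Fin D) (Fin D) ℂ)
    (h : Fin (M + 1) → ℝ → ℝ) (t : ℝ) :
    Complex.I • hamiltonian H h t ∈ dynamicalLieAlgebra H := by
  rw [hamiltonian, Finset.smul_sum]
  refine sum_mem fun m _ => ?_
  have h1 : Complex.I • ((h m t : ℝ) : ℂ) • H m = (h m t) • (Complex.I • H m) := by
    rw [smul_comm, Complex.coe_smul]
  rw [h1]
  exact (dynamicalLieAlgebra H).smul_mem _ (LieSubalgebra.subset_lieSpan ⟨m, rfl⟩)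

/-- Existence of a Hermitian generator whose norm is at most the length of the evolution. -/
theorem exists_hermitianGenerator_le {H : Fin (M + 1) → Matrix (Fin D) (Fin D) ℂ}
    (hH : ∀ m, (H m).IsHermitian) {h : Fin (M + 1) → ℝ → ℝ} {T : ℝ} (hT : 0 ≤ T)
    (hpc : IsPiecewiseContinuous (hamiltonian H h) T) {U : ℝ → Matrix (Fin D) (Fin D) ℂ}
    (hU : IsSchrodingerSolution (hamiltonian H h) T U) :
    ∃ C ∈ hermitianGenerators H (U T),
      frobeniusNorm C ≤ ∫ t in (0 : ℝ)..T, frobeniusNorm (hamiltonian H h t) := by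
  obtain ⟨hU0, hUc, S, hS, hUd⟩ := hU
  obtain ⟨⟨K, hK⟩, S', hS', hFc⟩ := hpc
  set F : ℝ → Matrix (Fin D) (Fin D) ℂ := fun t => -(Complex.I • hamiltonian H h t) with hF
  have hnF : ∀ t, ‖F t‖ = frobeniusNorm (hamiltonian H h t) := fun t => by
    rw [hF, norm_neg, norm_smul, Complex.norm_I, one_mul, frobeniusNorm_eq_norm]
  obtain ⟨X, hX, hXe, hXn⟩ := exists_exp_eq_endpoint (L := (dynamicalLieAlgebra H).toSubmodule)
    (F := F) (U := U) (T := T) (K := K) (S := S)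
    (fun t _ => neg_mem (I_smul_hamiltonian_mem H h t)) (fun t ht => (hnF t).trans_le (hK t ht))
    (integrableOn_Icc_of_bounded_of_continuousOn_diff_finite
      (fun t ht => (hnF t).trans_le (hK t ht)) hS' (hFc.const_smul Complex.I).neg) hUc hS.countable
    (fun t ht => by
      obtain ⟨U', hU', hUe⟩ := hUd t ⟨Ioo_subset_Icc_self ht.1, ht.2⟩
      have h1 := hU'.hasDerivAt (Icc_mem_nhds ht.1.1 ht.1.2)
      have h2 : U' = F t * U t := by
        rw [hF, neg_mul, smul_mul_assoc, ← hUe, smul_smul, Complex.I_mul_I, neg_one_smul, neg_neg]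
      rwa [h2] at h1)
    (fun A hA B hB => commutator_mem_dynamicalLieAlgebra hA hB)
    frobeniusForm frobeniusForm_self frobeniusForm_comm
    (fun A hA Y _ =>
      frobeniusForm_commutator (conjTranspose_eq_neg_of_mem_dynamicalLieAlgebra hH hA) Y)
    hT hU0
  -- The generator is `C = i X`, so that `-(i C) = X`.
  have hIX : Complex.I • Complex.I • X = -X := by
    rw [smul_smul, Complex.I_mul_I, neg_one_smul]
  refine ⟨Complex.I • X, ⟨?_, ?_, ?_⟩, ?_⟩
  · rw [Matrix.IsHermitian, Matrix.conjTranspose_smul,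
      conjTranspose_eq_neg_of_mem_dynamicalLieAlgebra hH hX]
    simp
  · rw [hIX, neg_neg]
    exact hXe
  · rw [hIX]
    exact neg_mem (s := dynamicalLieAlgebra H) hX
  · rw [frobeniusNorm_eq_norm, norm_smul, Complex.norm_I, one_mul]
    simpa only [hnF] using hXn

theorem isClosed_hermitianGenerators (H : Fin (M + 1) → Matrix (Fin D) (Fin D) ℂ)
    (V : Matrix (Fin D) (Fin D) ℂ) : IsClosed (hermitianGenerators H V) := by
  have h1 : IsClosed {C : Matrix (Fin D) (Fin D) ℂ | C.IsHermitian} :=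
    isClosed_eq (continuous_id.matrix_conjTranspose) continuous_id
  have h2 : IsClosed {C : Matrix (Fin D) (Fin D) ℂ | NormedSpace.exp (-(Complex.I • C)) = V} :=
    isClosed_eq (continuous_exp_real.comp (continuous_id.const_smul Complex.I).neg)
      continuous_const
  have h3 : IsClosed ((dynamicalLieAlgebra H).toSubmodule : Set (Matrix (Fin D) (Fin D) ℂ)) :=
    Submodule.closed_of_finiteDimensional _
  exact h1.inter (h2.inter (h3.preimage (continuous_id.const_smul Complex.I)))

theorem exists_isLeast_frobeniusNorm_hermitianGenerators
    (H : Fin (M + 1) → Matrix (Fin D) (Fin D) ℂ) (V : Matrix (Fin D) (Fin D) ℂ)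
    (hne : (hermitianGenerators H V).Nonempty) :
    ∃ c : ℝ, IsLeast (frobeniusNorm '' hermitianGenerators H V) c := by
  have : ProperSpace (Matrix (Fin D) (Fin D) ℂ) := FiniteDimensional.proper ℝ _
  -- A minimal generator is a point of a closed set nearest to `0` in a proper space.
  obtain ⟨C, hC, hd⟩ := (isClosed_hermitianGenerators H V).exists_infDist_eq_dist hne 0
  refine ⟨frobeniusNorm C, ⟨C, hC, rfl⟩, ?_⟩
  rintro _ ⟨C', hC', rfl⟩
  have := Metric.infDist_le_dist_of_mem (x := 0) hC'
  rwa [hd, dist_zero_left, dist_zero_left, ← frobeniusNorm_eq_norm,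
    ← frobeniusNorm_eq_norm] at this

end MatrixApplication

end

theorem theorem1 {D M : ℕ} (H : Fin (M + 1) → Matrix (Fin D) (Fin D) ℂ)
    (hH : ∀ m, (H m).IsHermitian) (h : Fin (M + 1) → ℝ → ℝ) (T : ℝ) (hT : 0 ≤ T)
    (hpc : IsPiecewiseContinuous (hamiltonian H h) T)
    (U : ℝ → Matrix (Fin D) (Fin D) ℂ) (hU : IsSchrodingerSolution (hamiltonian H h) T U) :
    IntervalIntegrable (fun t => frobeniusNorm (hamiltonian H h t)) MeasureTheory.volume 0 T ∧
    (∃ C : Matrix (Fin D) (Fin D) ℂ,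
      C.IsHermitian ∧
      NormedSpace.exp (-(Complex.I • C)) = U T ∧
      Complex.I • C ∈ dynamicalLieAlgebra H ∧
      frobeniusNorm C ≤ ∫ t in (0 : ℝ)..T, frobeniusNorm (hamiltonian H h t)) ∧
    (∃ c : ℝ, IsLeast (frobeniusNorm '' hermitianGenerators H (U T)) c ∧
      ∀ K : ℝ, (∀ t ∈ Set.Icc (0 : ℝ) T, frobeniusNorm (hamiltonian H h t) ≤ K) →
        c ≤ K * T ∧ (U T ≠ 1 → 0 < K ∧ c / K ≤ T)) := by
  have hint : IntervalIntegrable (fun t => frobeniusNorm (hamiltonian H h t))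
      MeasureTheory.volume 0 T := by
    obtain ⟨⟨K, hK⟩, S, hS, hc⟩ := hpc
    rw [intervalIntegrable_iff_integrableOn_Icc_of_le hT]
    simp only [frobeniusNorm_eq_norm] at hK ⊢
    let _ := Matrix.frobeniusNormedAddCommGroup (m := Fin D) (n := Fin D) (α := ℂ)
    exact (integrableOn_Icc_of_bounded_of_continuousOn_diff_finite
      (E := Matrix (Fin D) (Fin D) ℂ) hK hS hc).norm
  obtain ⟨C, hC, hCn⟩ := exists_hermitianGenerator_le hH hT hpc hU
  obtain ⟨c, hc⟩ := exists_isLeast_frobeniusNorm_hermitianGenerators H (U T) ⟨C, hC⟩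
  refine ⟨hint, ⟨C, hC.1, hC.2.1, hC.2.2, hCn⟩, c, hc, fun K hK => ?_⟩
  have hcK : c ≤ K * T := by
    have h1 : (∫ t in (0 : ℝ)..T, frobeniusNorm (hamiltonian H h t)) ≤ ∫ _ in (0 : ℝ)..T, K :=
      intervalIntegral.integral_mono_on hT hint intervalIntegrable_const hK
    rw [intervalIntegral.integral_const, sub_zero, smul_eq_mul, mul_comm] at h1
    exact (hc.2 ⟨C, hC, rfl⟩).trans (hCn.trans h1)
  refine ⟨hcK, fun hUT => ?_⟩
  obtain ⟨C₀, hC₀, hC₀c⟩ := hc.1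
  -- If the minimum were `0`, the minimizing generator would vanish and `U T = exp 0 = 1`.
  have hcpos : 0 < c := by
    rw [← hC₀c]
    refine (Real.sqrt_nonneg _).lt_of_ne fun h0 => hUT ?_
    have h1 : C₀ = 0 := by
      let _ := Matrix.frobeniusNormedAddCommGroup (m := Fin D) (n := Fin D) (α := ℂ)
      have h2 := frobeniusNorm_eq_norm C₀
      rw [← norm_eq_zero, ← h2]
      exact h0.symm
    rw [← hC₀.2.1, h1, smul_zero, neg_zero, NormedSpace.exp_zero]
  have hKpos : 0 < K := pos_of_mul_pos_left (hcpos.trans_le hcK) hT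
  exact ⟨hKpos, (div_le_iff₀ hKpos).2 (by linarith)⟩
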